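/- Let $A$ be a separable (not necessarily unital) C*-algebra, and let $\alpha \in \mathrm{Aut}(A)$ be an automorphism with finite Rokhlin dimension. That is, there is $d \in \mathbb{Z}_{\ge 0}$ such that for every finite set $F \subset A$, every integer $p > 0$ and every $\varepsilon > 0$ there are positive contractions $f^{(l)}_{r,j} \in A$, for $l = 0, \dots, d$, $r \in \{0,1\}$ and $0 \le j < p + r$, such that for all $b \in F$ and all $l$: 1. $\| f^{(l)}_{q,i} f^{(l)}_{r,j} b \| < \varepsilon$ whenever $(q,i) \ne (r,j)$; 2. $\big\| \big( \sum_{l=0}^{d} \sum_{r=0}^{1} \sum_{j=0}^{p+r-1} f^{(l)}_{r,j} \big) b - b \big\| < \varepsilon$; 3. $\| ( \alpha(f^{(l)}_{r,j}) - f^{(l)}_{r,j+1} ) b \| < \varepsilon$ for $r \in \{0,1\}$ and $0 \le j < p + r - 1$; 4. $\big\| \big( \alpha( f^{(l)}_{0,p-1} + f^{(l)}_{1,p} ) - ( f^{(l)}_{0,0} + f^{(l)}_{1,0} ) \big) b \big\| < \varepsilon$; 5. $\| f^{(l)}_{r,j} b - b f^{(l)}_{r,j} \| < \varepsilon$ for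 all $r, j$. Let $A \rtimes_\alpha \mathbb{Z}$ be the crossed product, that is, the completion of the convolution *-algebra $C_c(\mathbb{Z}, A)$ of finite sums $\sum_n a_n u^n$ (with $u a u^* = \alpha(a)$) in its universal C*-norm, and let $P \colon A \rtimes_\alpha \mathbb{Z} \to A$ be the canonical conditional expectation, $P\big(\sum_n a_n u^n\big) = a_0$. A tracial state is a positive linear functional $\tau$ of norm one with $\tau(xy) = \tau(yx)$ for all $x, y$. Then for every tracial state $\tau$ on $A \rtimes_\alpha \mathbb{Z}$ there is a tracial state $\rho$ on $A$ which is $\alpha$-invariant ($\rho \circ \alpha = \rho$) such that $\tau = \rho \circ P$. -/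

import Mathlib

noncomputable section

open scoped ComplexOrder

namespace CrossedProd

variable {A : Type*} [NonUnitalCStarAlgebra A]

/-- The algebra `C_c(ℤ, A)` of finitely supported functions `ℤ → A`, written as finite formal sums
`∑ aₙ uⁿ`, with the convolution product and involution twisted by the automorphism `α`, that is,
`(a uᵐ) (b uⁿ) = a αᵐ(b) uᵐ⁺ⁿ` and `(a uᵐ)* = α⁻ᵐ(a*) u⁻ᵐ`. -/
def ConvAlg (_α : A ≃⋆ₐ[ℂ] A) : Type _ := ℤ →₀ A

variable {α : A ≃⋆ₐ[ℂ] A}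

namespace ConvAlg

instance : AddCommGroup (ConvAlg α) := inferInstanceAs (AddCommGroup (ℤ →₀ A))
instance : Module ℂ (ConvAlg α) := inferInstanceAs (Module ℂ (ℤ →₀ A))

/-- The underlying finitely supported function. -/
def toFinsupp : ConvAlg α ≃ₗ[ℂ] (ℤ →₀ A) := LinearEquiv.refl ℂ _

/-- The `n`-th coefficient of a formal sum `∑ aₙ uⁿ`. -/
def coeff (f : ConvAlg α) (n : ℤ) : A := toFinsupp f n

/-- The element `a uⁿ`. -/
def mono (α : A ≃⋆ₐ[ℂ] A) (n : ℤ) : A →ₗ[ℂ] ConvAlg α :=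
  toFinsupp.symm.toLinearMap ∘ₗ Finsupp.lsingle n

@[simp] lemma toFinsupp_mono (n : ℤ) (a : A) : toFinsupp (mono α n a) = Finsupp.single n a := rfl

instance : Mul (ConvAlg α) :=
  ⟨fun f g => (toFinsupp f).sum fun m a => (toFinsupp g).sum fun n b => mono α (m + n) (a * (α ^ m) b)⟩

instance : Star (ConvAlg α) :=
  ⟨fun f => (toFinsupp f).sum fun m a => mono α (-m) ((α ^ (-m)) (star a))⟩

/-- The `ℓ¹`-norm `∑ ‖aₙ‖` of a formal sum `∑ aₙ uⁿ`. -/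
def l1Norm (f : ConvAlg α) : ℝ := (toFinsupp f).sum fun _ a => ‖a‖

@[elab_as_elim]
lemma induction {P : ConvAlg α → Prop} (f : ConvAlg α) (h0 : P 0)
    (hadd : ∀ f g, P f → P g → P (f + g)) (hm : ∀ n a, P (mono α n a)) : P f :=
  Finsupp.induction_linear f h0 hadd hm

@[ext]
lemma ext {f g : ConvAlg α} (h : ∀ n, f.coeff n = g.coeff n) : f = g := Finsupp.ext h

@[simp] lemma coeff_zero (n : ℤ) : (0 : ConvAlg α).coeff n = 0 := rfl
@[simp] lemma coeff_add (f g : ConvAlg α) (n : ℤ) : (f + g).coeff n = f.coeff n + g.coeff n := rfl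
@[simp] lemma coeff_smul (c : ℂ) (f : ConvAlg α) (n : ℤ) : (c • f).coeff n = c • f.coeff n := rfl
lemma coeff_mono (m n : ℤ) (a : A) : (mono α m a).coeff n = if m = n then a else 0 := by
  rw [coeff, toFinsupp_mono, Finsupp.single_apply]
lemma smul_mono (c : ℂ) (n : ℤ) (a : A) : c • mono α n a = mono α n (c • a) :=
  (map_smul _ c a).symm

lemma zpow_add_apply (m n : ℤ) (a : A) : (α ^ (m + n)) a = (α ^ m) ((α ^ n) a) := by
  rw [zpow_add, StarAlgEquiv.mul_apply]

lemma mul_def (f g : ConvAlg α) : f * g = (toFinsupp f).sum fun m a => (toFinsupp g).sum fun n b =>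
  mono α (m + n) (a * (α ^ m) b) := rfl

lemma star_def (f : ConvAlg α) :
    star f = (toFinsupp f).sum fun m a => mono α (-m) ((α ^ (-m)) (star a)) := rfl

lemma mono_mul_mono (m n : ℤ) (a b : A) :
    mono α m a * mono α n b = mono α (m + n) (a * (α ^ m) b) := by
  rw [mul_def, toFinsupp_mono, toFinsupp_mono, Finsupp.sum_single_index,
    Finsupp.sum_single_index] <;> simp

lemma star_mono (m : ℤ) (a : A) : star (mono α m a) = mono α (-m) ((α ^ (-m)) (star a)) := by
  rw [star_def, toFinsupp_mono, Finsupp.sum_single_index]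
  simp

instance : NonUnitalNonAssocRing (ConvAlg α) where
  left_distrib f g h := by
    simp only [mul_def, map_add]
    rw [← Finsupp.sum_add]
    refine Finset.sum_congr rfl fun m _ => ?_
    exact Finsupp.sum_add_index' (by simp) (by simp [mul_add])
  right_distrib f g h := by
    simp only [mul_def, map_add]
    refine Finsupp.sum_add_index' (by simp) fun m a b => ?_
    simp [add_mul, Finsupp.sum_add]
  zero_mul f := by simp [mul_def]
  mul_zero f := by
    simp only [mul_def, map_zero]
    exact Finset.sum_eq_zero fun m _ => Finsupp.sum_zero_index

instance : NonUnitalRing (ConvAlg α) where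
  mul_assoc f g h := by
    induction f using induction with
    | h0 => simp
    | hadd f f' hf hf' => simp [add_mul, hf, hf']
    | hm l a =>
    induction g using induction with
    | h0 => simp
    | hadd f f' hf hf' => simp [add_mul, mul_add, hf, hf']
    | hm m b =>
    induction h using induction with
    | h0 => simp
    | hadd f f' hf hf' => simp [mul_add, hf, hf']
    | hm n c => simp [mono_mul_mono, add_assoc, mul_assoc, zpow_add_apply]

lemma star_add' (f g : ConvAlg α) : star (f + g) = star f + star g := by
  simp only [star_def, map_add]
  exact Finsupp.sum_add_index' (by simp) (by simp)

lemma star_zero' : star (0 : ConvAlg α) = 0 := Finsupp.sum_zero_index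

lemma zpow_neg_zpow (m : ℤ) (a : A) : (α ^ (-m)) ((α ^ m) a) = a := by
  rw [← zpow_add_apply]; simp

lemma zpow_zpow_neg (m : ℤ) (a : A) : (α ^ m) ((α ^ (-m)) a) = a := by
  rw [← zpow_add_apply]; simp

instance : StarRing (ConvAlg α) where
  star_involutive f := by
    induction f using induction with
    | h0 => simp [star_zero']
    | hadd f f' hf hf' => simp [star_add', hf, hf']
    | hm l a => 
      rw [star_mono, star_mono, ← map_star, star_star, neg_neg, zpow_zpow_neg]
  star_mul f g := by
    induction f using induction with
    | h0 => simp [star_zero']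
    | hadd f f' hf hf' => simp [star_add', add_mul, mul_add, hf, hf']
    | hm l a =>
    induction g using induction with
    | h0 => simp [star_zero']
    | hadd f f' hf hf' => simp [star_add', add_mul, mul_add, hf, hf']
    | hm m b =>
      simp only [star_mono, mono_mul_mono, star_mul, map_mul, neg_add_rev, zpow_add_apply,
        ← map_star, zpow_neg_zpow]
  star_add := star_add'

instance : IsScalarTower ℂ (ConvAlg α) (ConvAlg α) where
  smul_assoc c f g := by
    simp only [smul_eq_mul]
    induction f using induction with
    | h0 => simp
    | hadd f f' hf hf' => simp [smul_add, add_mul, hf, hf']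
    | hm l a =>
    induction g using induction with
    | h0 => simp
    | hadd f f' hf hf' => simp [mul_add, smul_add, hf, hf']
    | hm m b => simp only [smul_mono, mono_mul_mono, smul_mul_assoc]

instance : SMulCommClass ℂ (ConvAlg α) (ConvAlg α) where
  smul_comm c f g := by
    simp only [smul_eq_mul]
    induction f using induction with
    | h0 => simp
    | hadd f f' hf hf' => simp [smul_add, add_mul, hf, hf']
    | hm l a =>
    induction g using induction with
    | h0 => simp
    | hadd f f' hf hf' => simp [mul_add, smul_add, hf, hf']
    | hm m b => simp only [smul_mono, mono_mul_mono, mul_smul_comm, map_smul (α ^ l)]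

instance : StarModule ℂ (ConvAlg α) where
  star_smul c f := by
    induction f using induction with
    | h0 => simp
    | hadd f f' hf hf' => simp [smul_add, hf, hf']
    | hm l a => simp only [smul_mono, star_mono, star_smul, map_smul (α ^ (-l))]

/-- A C*-seminorm on `C_c(ℤ, A)` dominated by the `ℓ¹`-norm. These are exactly the seminorms
`f ↦ ‖π f‖` for `ℓ¹`-contractive *-representations `π` of `C_c(ℤ, A)` on Hilbert spaces. -/
structure IsCStarSeminorm (p : Seminorm ℂ (ConvAlg α)) : Prop where
  mul_le : ∀ f g, p (f * g) ≤ p f * p g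
  star_mul_self : ∀ f, p (star f * f) = p f ^ 2
  le_l1Norm : ∀ f, p f ≤ l1Norm f

/-- The universal C*-norm on `C_c(ℤ, A)`: the supremum of all C*-seminorms. -/
def universalSeminorm (α : A ≃⋆ₐ[ℂ] A) : Seminorm ℂ (ConvAlg α) :=
  sSup {p | IsCStarSeminorm p}

lemma bddAbove_cstarSeminorms : BddAbove {p : Seminorm ℂ (ConvAlg α) | IsCStarSeminorm p} := by
  rw [Seminorm.bddAbove_iff]
  refine ⟨l1Norm, ?_⟩
  rintro _ ⟨p, hp, rfl⟩ f
  exact hp.le_l1Norm f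

instance : Nonempty {p : Seminorm ℂ (ConvAlg α) // IsCStarSeminorm p} :=
  ⟨0, by simp, by simp, fun f =>
    Finset.sum_nonneg fun _ _ => norm_nonneg _⟩

lemma universalSeminorm_apply (f : ConvAlg α) :
    universalSeminorm α f = ⨆ p : {p : Seminorm ℂ (ConvAlg α) // IsCStarSeminorm p}, p.1 f :=
  Seminorm.sSup_apply bddAbove_cstarSeminorms

lemma IsCStarSeminorm.le_universal {p : Seminorm ℂ (ConvAlg α)} (hp : IsCStarSeminorm p)
    (f : ConvAlg α) : p f ≤ universalSeminorm α f := by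
  rw [universalSeminorm_apply]
  exact le_ciSup (f := fun q : {p : Seminorm ℂ (ConvAlg α) // IsCStarSeminorm p} => q.1 f)
    ⟨l1Norm f, by rintro _ ⟨q, rfl⟩; exact q.2.le_l1Norm f⟩ ⟨p, hp⟩

lemma universalSeminorm_le {f : ConvAlg α} {C : ℝ}
    (h : ∀ p : Seminorm ℂ (ConvAlg α), IsCStarSeminorm p → p f ≤ C) :
    universalSeminorm α f ≤ C := by
  rw [universalSeminorm_apply]
  exact ciSup_le fun p => h p.1 p.2

lemma universalSeminorm_isCStarSeminorm : IsCStarSeminorm (universalSeminorm α) where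
  mul_le f g := universalSeminorm_le fun p hp => (hp.mul_le f g).trans <|
    mul_le_mul (hp.le_universal f) (hp.le_universal g) (apply_nonneg p g) (apply_nonneg _ f)
  star_mul_self f := by
    apply le_antisymm
    · exact universalSeminorm_le fun p hp => (hp.star_mul_self f).le.trans <|
        pow_le_pow_left₀ (apply_nonneg p f) (hp.le_universal f) 2
    · refine Real.le_sqrt (apply_nonneg _ f) (apply_nonneg _ _) |>.mp <|
        universalSeminorm_le fun p hp => Real.le_sqrt (apply_nonneg _ f) (apply_nonneg _ _) |>.mpr ?_
      exact (hp.star_mul_self f).symm.le.trans (hp.le_universal _)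
  le_l1Norm f := universalSeminorm_le fun p hp => hp.le_l1Norm f

lemma IsCStarSeminorm.star_le {p : Seminorm ℂ (ConvAlg α)} (hp : IsCStarSeminorm p)
    (f : ConvAlg α) : p f ≤ p (star f) := by
  rcases (apply_nonneg p f).eq_or_lt with h | h
  · rw [← h]; exact apply_nonneg _ _
  · have := (hp.star_mul_self f).symm.le.trans (hp.mul_le _ _)
    nlinarith

lemma IsCStarSeminorm.star_eq {p : Seminorm ℂ (ConvAlg α)} (hp : IsCStarSeminorm p)
    (f : ConvAlg α) : p (star f) = p f :=
  le_antisymm (by simpa using hp.star_le (star f)) (hp.star_le f)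

section Regular

lemma coeff_zero_mono_mul (a : A) (f : ConvAlg α) : (mono α 0 a * f).coeff 0 = a * f.coeff 0 := by
  induction f using induction with
  | h0 => simp
  | hadd f f' hf hf' => simp [mul_add, hf, hf']
  | hm n b => simp [mono_mul_mono, coeff_mono]

lemma star_coeff_zero (f : ConvAlg α) : star (f.coeff 0) = (star f).coeff 0 := by
  induction f using induction with
  | h0 => simp
  | hadd f f' hf hf' => simp [hf, hf']
  | hm n b =>
    rw [star_mono, coeff_mono, coeff_mono]
    by_cases h : n = 0 <;> simp [h]

lemma coeff_zero_mul_star (f g : ConvAlg α) :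
    (g * star f).coeff 0 = (toFinsupp g).sum fun n b => b * star (f.coeff n) := by
  induction g using induction with
  | h0 => simp
  | hadd g g' hg hg' =>
    rw [map_add, Finsupp.sum_add_index' (by simp) (by simp [add_mul]), ← hg, ← hg', add_mul,
      coeff_add]
  | hm n b =>
    rw [toFinsupp_mono, Finsupp.sum_single_index (by simp)]
    induction f using induction with
    | h0 => simp
    | hadd f f' hf hf' => simp [hf, hf', mul_add]
    | hm m a =>
      rw [star_mono, mono_mul_mono, coeff_mono, coeff_mono]
      by_cases h : m = n
      · subst h; simp [zpow_zpow_neg, -zpow_neg]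
      · have : n + -m ≠ 0 := by omega
        simp [h, this]

lemma toFinsupp_mul_mono_zero (x : ConvAlg α) (b : A) (n : ℤ) :
    (x * mono α 0 b).coeff n = x.coeff n * (α ^ n) b := by
  induction x using induction with
  | h0 => simp
  | hadd f f' hf hf' => simp [add_mul, hf, hf']
  | hm m a =>
    rw [mono_mul_mono, coeff_mono, coeff_mono]
    by_cases h : m = n
    · subst h; simp
    · simp [h]

lemma coeff_zero_mul_star' (f g : ConvAlg α) {s : Finset ℤ} (hs : (toFinsupp g).support ⊆ s) :
    (g * star f).coeff 0 = ∑ n ∈ s, g.coeff n * star (f.coeff n) := by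
  rw [coeff_zero_mul_star]
  exact Finsupp.sum_of_support_subset _ hs _ (by simp)

/-- The standard Hilbert module `ℓ²(ℤ, A)`, restricted to finitely supported functions. -/
def RegMod (α : A ≃⋆ₐ[ℂ] A) : Type _ := ConvAlg α

namespace RegMod

instance : AddCommGroup (RegMod α) := inferInstanceAs (AddCommGroup (ConvAlg α))
instance : Module ℂ (RegMod α) := inferInstanceAs (Module ℂ (ConvAlg α))

/-- The identity map from `C_c(ℤ, A)` to the Hilbert module. -/
def of : ConvAlg α ≃ₗ[ℂ] RegMod α := LinearEquiv.refl ℂ _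

instance : SMul A (RegMod α) := ⟨fun a x => of (mono α 0 a * of.symm x)⟩
instance : Inner A (RegMod α) := ⟨fun x y => (of.symm y * star (of.symm x)).coeff 0⟩
instance : Norm (RegMod α) := ⟨fun x => √‖inner A x x‖⟩

lemma inner_def (x y : RegMod α) : inner A x y = (of.symm y * star (of.symm x)).coeff 0 := rfl
lemma smul_def (a : A) (x : RegMod α) : a • x = of (mono α 0 a * of.symm x) := rfl

variable [PartialOrder A] [StarOrderedRing A]

instance : CStarModule A (RegMod α) where
  inner_add_right := by simp [inner_def, add_mul]
  inner_self_nonneg {x} := by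
    rw [inner_def, coeff_zero_mul_star]
    exact Finset.sum_nonneg fun n _ => mul_star_self_nonneg _
  inner_self {x} := by
    constructor
    · intro h
      rw [inner_def, coeff_zero_mul_star' _ _ subset_rfl,
        Finset.sum_eq_zero_iff_of_nonneg fun n _ => mul_star_self_nonneg _] at h
      apply of.symm.injective
      ext n
      by_contra hn
      exact hn ((CStarRing.mul_star_self_eq_zero_iff _).mp
        (h n (Finsupp.mem_support_iff.mpr hn)))
    · rintro rfl; simp [inner_def]
  inner_op_smul_right {a x y} := by
    simp [inner_def, smul_def, mul_assoc, coeff_zero_mono_mul]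
  inner_smul_right_complex := by simp [inner_def, smul_mul_assoc]
  star_inner x y := by simp [inner_def, star_coeff_zero]
  norm_eq_sqrt_norm_inner_self _ := rfl

instance : NormedAddCommGroup (RegMod α) := CStarModule.normedAddCommGroup A
instance : NormedSpace ℂ (RegMod α) := .ofCore (CStarModule.normedSpaceCore A)

lemma norm_sq (x : RegMod α) : ‖x‖ ^ 2 = ‖(of.symm x * star (of.symm x)).coeff 0‖ :=
  CStarModule.norm_sq_eq A

lemma norm_zpow (n : ℤ) (a : A) : ‖(α ^ n) a‖ = ‖a‖ :=
  NonUnitalStarAlgHom.norm_map (α ^ n) (α ^ n).injective a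

lemma norm_mul_mono_le (f : ConvAlg α) (n : ℤ) (a : A) :
    ‖of (f * mono α n a)‖ ≤ ‖a‖ * ‖of f‖ := by
  have h1 : (f * mono α n a) * star (f * mono α n a) =
      (f * mono α 0 (a * star a)) * star f := by
    simp only [star_mul, mul_assoc]
    rw [← mul_assoc (mono α n a), star_mono, mono_mul_mono, zpow_zpow_neg, add_neg_cancel]
  have hs : (toFinsupp (f * mono α 0 (a * star a))).support ⊆ (toFinsupp f).support := by
    intro m hm
    rw [Finsupp.mem_support_iff] at hm ⊢
    intro h0
    apply hm
    have := toFinsupp_mul_mono_zero f (a * star a) m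
    rw [coeff, coeff, h0, zero_mul] at this
    exact this
  refine le_of_sq_le_sq ?_ (by positivity)
  rw [mul_pow, norm_sq, norm_sq, of.symm_apply_apply, of.symm_apply_apply, h1,
    coeff_zero_mul_star' _ _ hs, coeff_zero_mul_star' f f subset_rfl]
  have key : ‖∑ m ∈ (toFinsupp f).support,
      (f * mono α 0 (a * star a)).coeff m * star (f.coeff m)‖ ≤
      ‖‖a‖ ^ 2 • ∑ m ∈ (toFinsupp f).support, f.coeff m * star (f.coeff m)‖ := by
    apply CStarAlgebra.norm_le_norm_of_nonneg_of_le
    · refine Finset.sum_nonneg fun m _ => ?_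
      rw [toFinsupp_mul_mono_zero, map_mul, map_star, ← mul_assoc, mul_assoc, ← star_mul]
      exact mul_star_self_nonneg _
    · rw [Finset.smul_sum]
      refine Finset.sum_le_sum fun m _ => ?_
      rw [toFinsupp_mul_mono_zero]
      have hsa : IsSelfAdjoint ((α ^ m) (a * star a)) := by
        rw [IsSelfAdjoint, ← map_star, star_mul, star_star]
      have := CStarAlgebra.star_right_conjugate_le_norm_smul (a := f.coeff m) hsa
      rwa [norm_zpow, CStarRing.norm_self_mul_star, ← sq] at this
  refine key.trans (le_of_eq ?_)
  rw [norm_smul, Real.norm_of_nonneg (by positivity)]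

lemma norm_mul_le (x f : ConvAlg α) : ‖of (x * f)‖ ≤ l1Norm f * ‖of x‖ := by
  have h : of (x * f) = ∑ n ∈ (toFinsupp f).support, of (x * mono α n (f.coeff n)) := by
    rw [← map_sum, ← Finset.mul_sum]
    congr 2
    apply toFinsupp.injective
    rw [map_sum]
    exact (Finsupp.sum_single (toFinsupp f)).symm
  rw [h, l1Norm, Finsupp.sum, Finset.sum_mul]
  exact norm_sum_le_of_le _ fun n _ => norm_mul_mono_le x n _

/-- The right regular representation of `C_c(ℤ, A)` on its Hilbert module. -/
def regRep : ConvAlg α →ₗ[ℂ] (RegMod α →L[ℂ] RegMod α) where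
  toFun f := LinearMap.mkContinuous
    { toFun := fun x => of (of.symm x * f)
      map_add' := fun x y => by simp [add_mul]
      map_smul' := fun c x => by simp [smul_mul_assoc] } (l1Norm f) fun x => norm_mul_le _ f
  map_add' f g := by
    ext x
    exact (congrArg of (mul_add (of.symm x) f g)).trans (map_add of _ _)
  map_smul' c f := by
    ext x
    exact (congrArg of (mul_smul_comm c (of.symm x) f)).trans (map_smul of _ _)

lemma regRep_apply (f : ConvAlg α) (x : RegMod α) : regRep f x = of (of.symm x * f) := rfl

lemma regRep_mul (f g : ConvAlg α) : regRep (f * g) = (regRep g).comp (regRep f) := by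
  ext x; simp [regRep_apply, mul_assoc]

lemma inner_regRep (f : ConvAlg α) (x y : RegMod α) :
    inner A (regRep f x) y = inner A x (regRep (star f) y) := by
  simp [inner_def, regRep_apply, mul_assoc]

lemma norm_regRep_mul_le (f g : ConvAlg α) :
    ‖regRep (f * g)‖ ≤ ‖regRep f‖ * ‖regRep g‖ := by
  rw [regRep_mul, mul_comm]
  exact ContinuousLinearMap.opNorm_comp_le _ _

lemma norm_regRep_sq_le (f : ConvAlg α) : ‖regRep f‖ ^ 2 ≤ ‖regRep (f * star f)‖ := by
  refine (Real.le_sqrt (norm_nonneg _) (norm_nonneg _)).mp ?_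
  refine ContinuousLinearMap.opNorm_le_bound _ (Real.sqrt_nonneg _) fun x => ?_
  refine le_of_sq_le_sq ?_ (by positivity)
  rw [mul_pow, Real.sq_sqrt (norm_nonneg _), CStarModule.norm_sq_eq A, inner_regRep,
    ← ContinuousLinearMap.comp_apply, ← regRep_mul]
  calc _ ≤ ‖x‖ * ‖regRep (f * star f) x‖ := CStarModule.norm_inner_le (RegMod α)
    _ ≤ ‖x‖ * (‖regRep (f * star f)‖ * ‖x‖) := by
        gcongr; exact ContinuousLinearMap.le_opNorm _ _
    _ = _ := by ring

lemma norm_regRep_le_star (f : ConvAlg α) : ‖regRep f‖ ≤ ‖regRep (star f)‖ := by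
  rcases (norm_nonneg (regRep f)).eq_or_lt with h | h
  · rw [← h]; exact norm_nonneg _
  · have := (norm_regRep_sq_le f).trans (norm_regRep_mul_le _ _)
    nlinarith

lemma norm_regRep_star (f : ConvAlg α) : ‖regRep (star f)‖ = ‖regRep f‖ :=
  le_antisymm (by simpa using norm_regRep_le_star (star f)) (norm_regRep_le_star f)

lemma isCStarSeminorm_regRep :
    IsCStarSeminorm ((normSeminorm ℂ (RegMod α →L[ℂ] RegMod α)).comp regRep) where
  mul_le f g := norm_regRep_mul_le f g
  star_mul_self f := by
    change ‖regRep (star f * f)‖ = ‖regRep f‖ ^ 2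
    apply le_antisymm
    · refine (norm_regRep_mul_le _ _).trans (le_of_eq ?_)
      rw [norm_regRep_star, sq]
    · rw [← norm_regRep_star]
      simpa using norm_regRep_sq_le (star f)
  le_l1Norm f := by
    change ‖regRep f‖ ≤ l1Norm f
    exact ContinuousLinearMap.opNorm_le_bound _ (Finset.sum_nonneg fun _ _ => norm_nonneg _)
      fun x => norm_mul_le _ f

lemma norm_coeff_le (f : ConvAlg α) (n : ℤ) : ‖f.coeff n‖ ≤ ‖of f‖ := by
  refine le_of_sq_le_sq ?_ (norm_nonneg _)
  rw [norm_sq, of.symm_apply_apply,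
    coeff_zero_mul_star' f f (Finset.subset_insert n _), sq, ← CStarRing.norm_self_mul_star]
  refine CStarAlgebra.norm_le_norm_of_nonneg_of_le (mul_star_self_nonneg _) ?_
  exact Finset.single_le_sum (f := fun m => f.coeff m * star (f.coeff m))
    (fun m _ => mul_star_self_nonneg _) (Finset.mem_insert_self n _)

lemma norm_of_mono (a : A) : ‖of (mono α 0 a)‖ = ‖a‖ := by
  rw [← sq_eq_sq₀ (norm_nonneg _) (norm_nonneg _), norm_sq, of.symm_apply_apply, star_mono,
    mono_mul_mono, coeff_mono]
  simp [CStarRing.norm_self_mul_star, sq]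

lemma norm_coeff_zero_le_regRep (f : ConvAlg α) : ‖f.coeff 0‖ ≤ ‖regRep f‖ := by
  have h : ‖f.coeff 0‖ * ‖f.coeff 0‖ ≤ ‖regRep f‖ * ‖f.coeff 0‖ := by
    calc ‖f.coeff 0‖ * ‖f.coeff 0‖ = ‖(mono α 0 (star (f.coeff 0)) * f).coeff 0‖ := by
          rw [coeff_zero_mono_mul, CStarRing.norm_star_mul_self]
      _ ≤ ‖regRep f (of (mono α 0 (star (f.coeff 0))))‖ := norm_coeff_le _ _
      _ ≤ ‖regRep f‖ * ‖of (mono α 0 (star (f.coeff 0)))‖ := ContinuousLinearMap.le_opNorm _ _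
      _ = _ := by rw [norm_of_mono, norm_star]
  rcases (norm_nonneg (f.coeff 0)).eq_or_lt with h0 | h0
  · rw [← h0]; exact norm_nonneg _
  · exact le_of_mul_le_mul_right h h0

end RegMod

lemma norm_coeff_zero_le (f : ConvAlg α) : ‖f.coeff 0‖ ≤ universalSeminorm α f := by
  let _ := CStarAlgebra.spectralOrder A
  have := CStarAlgebra.spectralOrderedRing A
  exact (RegMod.norm_coeff_zero_le_regRep f).trans
    (RegMod.isCStarSeminorm_regRep.le_universal f)

end Regular
instance : SeminormedAddCommGroup (ConvAlg α) :=
  (universalSeminorm α).toAddGroupSeminorm.toSeminormedAddCommGroup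

lemma norm_def (f : ConvAlg α) : ‖f‖ = universalSeminorm α f := rfl

instance : NonUnitalSeminormedRing (ConvAlg α) where
  __ := (inferInstance : SeminormedAddCommGroup (ConvAlg α))
  __ := (inferInstance : NonUnitalRing (ConvAlg α))
  norm_mul_le := universalSeminorm_isCStarSeminorm.mul_le

instance : NormedSpace ℂ (ConvAlg α) where
  norm_smul_le c f := (map_smul_eq_mul (universalSeminorm α) c f).le

instance : NormedStarGroup (ConvAlg α) where
  norm_star_le f := (universalSeminorm_isCStarSeminorm.star_eq f).le

/-- The map `∑ aₙ uⁿ ↦ a₀` on `C_c(ℤ, A)`. -/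
def coeffZero (α : A ≃⋆ₐ[ℂ] A) : ConvAlg α →L[ℂ] A :=
  LinearMap.mkContinuous
    { toFun := fun f => f.coeff 0, map_add' := fun _ _ => rfl, map_smul' := fun _ _ => rfl } 1
    fun f => (norm_coeff_zero_le f).trans (one_mul ‖f‖).ge

end ConvAlg

open UniformSpace

/-- The crossed product `A ⋊_α ℤ`: the completion of `C_c(ℤ, A)` in the universal C*-norm. -/
abbrev CrossedProduct (α : A ≃⋆ₐ[ℂ] A) : Type _ := Completion (ConvAlg α)

namespace CrossedProduct

instance : Mul (CrossedProduct α) :=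
  ⟨Function.curry <| (Completion.isDenseInducing_coe.prodMap Completion.isDenseInducing_coe).extend
    ((↑) ∘ Function.uncurry ((· * ·) : ConvAlg α → ConvAlg α → ConvAlg α))⟩

lemma coe_mul (f g : ConvAlg α) :
    ((f * g : ConvAlg α) : CrossedProduct α) = (f : CrossedProduct α) * (g : CrossedProduct α) :=
  ((Completion.isDenseInducing_coe.prodMap Completion.isDenseInducing_coe).extend_eq
      ((Completion.continuous_coe _).comp (@continuous_mul (ConvAlg α) _ _ _)) (f, g)).symm

instance : ContinuousMul (CrossedProduct α) where
  continuous_mul := by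
    let m := (AddMonoidHom.mul : ConvAlg α →+ ConvAlg α →+ ConvAlg α).compr₂ Completion.toCompl
    have : Continuous fun p : ConvAlg α × ConvAlg α => m p.1 p.2 :=
      (Completion.continuous_coe _).comp continuous_mul
    have di : IsDenseInducing (Completion.toCompl : ConvAlg α → CrossedProduct α) :=
      Completion.isDenseInducing_coe
    exact (di.extend_Z_bilin di this :)

instance : Star (CrossedProduct α) := ⟨Completion.map star⟩

lemma coe_star (f : ConvAlg α) :
    ((star f : ConvAlg α) : CrossedProduct α) = star (f : CrossedProduct α) :=
  (Completion.map_coe (starNormedAddGroupHom.uniformContinuous) f).symm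

instance : ContinuousStar (CrossedProduct α) := ⟨Completion.continuous_map⟩

instance : NonUnitalNormedRing (CrossedProduct α) where
  __ := (inferInstance : NormedAddCommGroup (CrossedProduct α))
  __ := (inferInstance : Mul (CrossedProduct α))
  left_distrib x y z := by
    induction x, y, z using Completion.induction_on₃ with
    | hp => exact isClosed_eq (by fun_prop) (by fun_prop)
    | ih x y z => simp only [← coe_mul, ← Completion.coe_add, mul_add]
  right_distrib x y z := by
    induction x, y, z using Completion.induction_on₃ with
    | hp => exact isClosed_eq (by fun_prop) (by fun_prop)
    | ih x y z => simp only [← coe_mul, ← Completion.coe_add, add_mul]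
  zero_mul x := by
    induction x using Completion.induction_on with
    | hp => exact isClosed_eq (by fun_prop) (by fun_prop)
    | ih x => rw [← Completion.coe_zero, ← coe_mul, zero_mul]
  mul_zero x := by
    induction x using Completion.induction_on with
    | hp => exact isClosed_eq (by fun_prop) (by fun_prop)
    | ih x => rw [← Completion.coe_zero, ← coe_mul, mul_zero]
  mul_assoc x y z := by
    induction x, y, z using Completion.induction_on₃ with
    | hp => exact isClosed_eq (by fun_prop) (by fun_prop)
    | ih x y z => simp only [← coe_mul, mul_assoc]
  norm_mul_le x y := by
    induction x, y using Completion.induction_on₂ with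
    | hp => exact isClosed_le (by fun_prop) (by fun_prop)
    | ih x y => simpa only [← coe_mul, Completion.norm_coe] using norm_mul_le x y

instance : StarRing (CrossedProduct α) where
  star_involutive x := by
    induction x using Completion.induction_on with
    | hp => exact isClosed_eq (by fun_prop) (by fun_prop)
    | ih x => simp only [← coe_star, star_star]
  star_mul x y := by
    induction x, y using Completion.induction_on₂ with
    | hp => exact isClosed_eq (by fun_prop) (by fun_prop)
    | ih x y => simp only [← coe_mul, ← coe_star, star_mul]
  star_add x y := by
    induction x, y using Completion.induction_on₂ with
    | hp => exact isClosed_eq (by fun_prop) (by fun_prop)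
    | ih x y => simp only [← Completion.coe_add, ← coe_star, star_add]

lemma smul_mul_eq (c : ℂ) (x y : CrossedProduct α) : (c • x) * y = c • (x * y) := by
  induction x, y using Completion.induction_on₂ with
  | hp =>
    exact isClosed_eq (((continuous_const_smul c).comp continuous_fst).mul continuous_snd)
      ((continuous_const_smul c).comp (continuous_fst.mul continuous_snd))
  | ih x y => simp only [← coe_mul, ← Completion.coe_smul, smul_mul_assoc]

lemma mul_smul_eq (c : ℂ) (x y : CrossedProduct α) : x * (c • y) = c • (x * y) := by
  induction x, y using Completion.induction_on₂ with
  | hp =>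
    exact isClosed_eq (continuous_fst.mul ((continuous_const_smul c).comp continuous_snd))
      ((continuous_const_smul c).comp (continuous_fst.mul continuous_snd))
  | ih x y => simp only [← coe_mul, ← Completion.coe_smul, mul_smul_comm]

lemma star_smul_eq (c : ℂ) (x : CrossedProduct α) : star (c • x) = star c • star x := by
  induction x using Completion.induction_on with
  | hp =>
    exact isClosed_eq (continuous_star.comp (continuous_const_smul c))
      ((continuous_const_smul (star c)).comp continuous_star)
  | ih x => simp only [← coe_star, ← Completion.coe_smul, star_smul]

instance : NonUnitalCStarAlgebra (CrossedProduct α) where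
  norm_mul_self_le x := by
    induction x using Completion.induction_on with
    | hp => exact isClosed_le (by fun_prop) (by fun_prop)
    | ih x =>
      rw [← coe_star, ← coe_mul, Completion.norm_coe, Completion.norm_coe, ← sq]
      exact (ConvAlg.universalSeminorm_isCStarSeminorm.star_mul_self x).ge
  smul_assoc c x y := smul_mul_eq c x y
  smul_comm c x y := (mul_smul_eq c x y).symm
  star_smul c x := star_smul_eq c x

/-- The canonical conditional expectation `P : A ⋊_α ℤ → A`, the continuous extension of
`∑ aₙ uⁿ ↦ a₀`. -/
def condExp (α : A ≃⋆ₐ[ℂ] A) : CrossedProduct α →L[ℂ] A := (ConvAlg.coeffZero α).fromCompletion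

lemma condExp_mono (n : ℤ) (a : A) :
    condExp α (ConvAlg.mono α n a : CrossedProduct α) = if n = 0 then a else 0 :=
  (ContinuousLinearMap.fromCompletion_apply_coe _ _).trans (ConvAlg.coeff_mono (α := α) n 0 a)

end CrossedProduct
/-- A tracial state on a C*-algebra: a positive linear functional of norm one with
`τ(xy) = τ(yx)`. -/
structure IsTracialState {B : Type*} [NonUnitalCStarAlgebra B] (τ : B →L[ℂ] ℂ) : Prop where
  nonneg : ∀ x, 0 ≤ τ (star x * x)
  norm_eq_one : ‖τ‖ = 1
  map_mul_comm : ∀ x y, τ (x * y) = τ (y * x)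

/-- The automorphism `α` of the (not necessarily unital) C*-algebra `A` has Rokhlin dimension at
most `d`: for every finite `F ⊆ A`, every `p ≥ 1` and every `ε > 0` there are positive contractions
`f l r j` (for `0 ≤ l ≤ d`, `r ∈ {0, 1}` and `0 ≤ j < p + r`; other values of `j` are irrelevant),
that is, for each colour `l` one tower of height `p` and one of height `p + 1`, which on `F` are
`ε`-almost orthogonal within each colour, sum to one up to `ε`, are cyclically permuted by `α` up
to `ε`, and commute up to `ε` with the elements of `F`. -/
def RokhlinDimLE [PartialOrder A] (α : A ≃⋆ₐ[ℂ] A) (d : ℕ) : Prop :=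
  ∀ (F : Finset A) (p : ℕ), 0 < p → ∀ ε : ℝ, 0 < ε →
    ∃ f : Fin (d + 1) → Fin 2 → ℕ → A,
      (∀ l (r : Fin 2), ∀ j < p + r, 0 ≤ f l r j ∧ ‖f l r j‖ ≤ 1) ∧
      (∀ l (q r : Fin 2), ∀ i < p + q, ∀ j < p + r, (q, i) ≠ (r, j) →
        ∀ b ∈ F, ‖f l q i * f l r j * b‖ < ε) ∧
      (∀ b ∈ F, ‖(∑ l, ∑ r : Fin 2, ∑ j ∈ Finset.range (p + r), f l r j) * b - b‖ < ε) ∧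
      (∀ l (r : Fin 2), ∀ j, j + 1 < p + r → ∀ b ∈ F, ‖(α (f l r j) - f l r (j + 1)) * b‖ < ε) ∧
      (∀ l, ∀ b ∈ F,
        ‖(α (f l 0 (p - 1) + f l 1 p) - (f l 0 0 + f l 1 0)) * b‖ < ε) ∧
      (∀ l (r : Fin 2), ∀ j < p + r, ∀ b ∈ F, ‖f l r j * b - b * f l r j‖ < ε)

/-- The automorphism `α` has finite Rokhlin dimension. -/
def HasFiniteRokhlinDim [PartialOrder A] (α : A ≃⋆ₐ[ℂ] A) : Prop := ∃ d, RokhlinDimLE α d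

end CrossedProd
end

/-!
A trace `τ` on `A ⋊_α ℤ` factors through the conditional expectation as soon as `τ (a uᵐ) = 0` for
all `a` and all `m ≠ 0`; the restriction of `τ` to `A` is then the required invariant trace.

The vanishing rests on two facts.

* If `g` is a self-adjoint element that almost cuts `x` down to zero, in the sense that `g x g` is
  small, then `τ (g x)` is small (`norm_trace_mul_le`). With `k` a function vanishing at `0` such
  that `t ≈ t k(t) t` uniformly, `g` is close to `g k(g) g`, and
  `τ (g k(g) g x) = τ (k(g) (g x g))`.
* For `m = n > 0`, Rokhlin towers of height `2n` and `2n + 1` consist of elements `f` for which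
  `f a αⁿ(f)` is small (`exists_almost_disjoint_towers`): the level `n` steps above or the level `n`
  steps below `f` lies in the same tower, and it is almost orthogonal to `f`. Thus `f (a uⁿ) f` is
  small, and similarly for `a u⁻ⁿ`.

The number of tower elements depends only on `n` and the Rokhlin dimension, and they sum
approximately to the identity, so `τ (a uᵐ) ≈ ∑ τ (f a uᵐ) ≈ 0`.
-/

namespace CrossedProd

open ConvAlg Filter Topology

/-! ### Traces and almost disjoint elements -/

section Trace

variable {B : Type*} [NonUnitalCStarAlgebra B]

/-- A self-adjoint element `g` is approximated by `g k g`, with the explicit choice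
`k = g (g² + s²)⁻¹`, which lies in the (possibly non-unital) algebra. -/
lemma exists_norm_sub_mul_mul_le {g : B} (hg : IsSelfAdjoint g) {s : ℝ} (hs : 0 < s) :
    ∃ k : B, ‖k‖ ≤ s⁻¹ ∧ ‖g - g * k * g‖ ≤ s := by
  have hpos (t : ℝ) : 0 < t ^ 2 + s ^ 2 := by positivity
  have hcont : Continuous fun t : ℝ => t / (t ^ 2 + s ^ 2) :=
    continuous_id.div (by fun_prop) fun t => (hpos t).ne'
  have hcont2 : Continuous fun t : ℝ => t * (t / (t ^ 2 + s ^ 2)) * t := by fun_prop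
  refine ⟨cfcₙ (fun t : ℝ => t / (t ^ 2 + s ^ 2)) g, norm_cfcₙ_le fun t _ => ?_, ?_⟩
  · rw [Real.norm_eq_abs, abs_div, abs_of_pos (hpos t), inv_eq_one_div, div_le_div_iff₀ (hpos t) hs]
    nlinarith [sq_nonneg (|t| - s), sq_abs t, sq_nonneg t, sq_nonneg s]
  · have h1 : g - g * cfcₙ (fun t : ℝ => t / (t ^ 2 + s ^ 2)) g * g =
        cfcₙ (fun t : ℝ => t - t * (t / (t ^ 2 + s ^ 2)) * t) g := by
      rw [cfcₙ_sub (fun t : ℝ => t) (fun t : ℝ => t * (t / (t ^ 2 + s ^ 2)) * t) g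
          (by fun_prop) rfl hcont2.continuousOn (by simp),
        cfcₙ_mul (fun t : ℝ => t * (t / (t ^ 2 + s ^ 2))) (fun t : ℝ => t) g
          (continuous_id.mul hcont).continuousOn (by simp) (by fun_prop) rfl,
        cfcₙ_mul (fun t : ℝ => t) (fun t : ℝ => t / (t ^ 2 + s ^ 2)) g
          (by fun_prop) rfl hcont.continuousOn (by simp), cfcₙ_id' ℝ g]
    rw [h1]
    refine norm_cfcₙ_le fun t _ => ?_
    have h2 : t - t * (t / (t ^ 2 + s ^ 2)) * t = t * s ^ 2 / (t ^ 2 + s ^ 2) := by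
      have := (hpos t).ne'
      field_simp
      ring
    rw [h2, Real.norm_eq_abs, abs_div, abs_of_pos (hpos t), div_le_iff₀ (hpos t), abs_mul,
      abs_of_nonneg (sq_nonneg s)]
    nlinarith [mul_nonneg hs.le (sq_nonneg (|t| - s)), sq_abs t, mul_nonneg hs.le (sq_nonneg t),
      pow_pos hs 3]

lemma norm_trace_mul_le {τ : B →L[ℂ] ℂ} (hτ : IsTracialState τ) {g : B} (hg : IsSelfAdjoint g)
    (x : B) {s : ℝ} (hs : 0 < s) : ‖τ (g * x)‖ ≤ s * ‖x‖ + s⁻¹ * ‖g * x * g‖ := by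
  obtain ⟨k, hk, hgk⟩ := exists_norm_sub_mul_mul_le hg hs
  have hle (y : B) : ‖τ y‖ ≤ ‖y‖ := by simpa [hτ.norm_eq_one] using τ.le_opNorm y
  have h1 : τ (g * x) = τ ((g - g * k * g) * x) + τ (k * (g * x * g)) := by
    have h2 : τ (g * k * g * x) = τ (k * (g * x * g)) := by
      rw [mul_assoc g k, mul_assoc g, hτ.map_mul_comm g]
      simp only [mul_assoc]
    rw [sub_mul, map_sub, h2, sub_add_cancel]
  rw [h1]
  refine (norm_add_le _ _).trans (add_le_add ?_ ?_)
  · exact (hle _).trans <| (norm_mul_le _ _).trans <| by gcongr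
  · exact (hle _).trans <| (norm_mul_le _ _).trans <| by gcongr

end Trace

/-! ### Rokhlin towers -/

section Towers

variable {A : Type*} [NonUnitalCStarAlgebra A] {α : A ≃⋆ₐ[ℂ] A}

lemma norm_aut_apply (β : A ≃⋆ₐ[ℂ] A) (a : A) : ‖β a‖ = ‖a‖ :=
  NonUnitalStarAlgHom.norm_map β β.injective a

/-- If `α` approximately shifts the sequence `h`, then `αⁿ` approximately maps `h 0` to `h n`. The
approximations are only valid after multiplication by test elements, which have to be translated
along with the steps. -/
lemma norm_zpow_sub_mul_le {n : ℕ} {ε : ℝ} {h : ℕ → A} {a : A}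
    (H : ∀ k < n, ∀ i < n, ‖(α (h k) - h (k + 1)) * (α ^ (-(i : ℤ))) a‖ ≤ ε) :
    ‖((α ^ (n : ℤ)) (h 0) - h n) * a‖ ≤ n * ε := by
  induction n generalizing a with
  | zero => simp
  | succ n ih =>
    have h1 : ((α ^ ((n + 1 : ℕ) : ℤ)) (h 0) - h (n + 1)) * a =
        (α ^ (1 : ℤ)) (((α ^ (n : ℤ)) (h 0) - h n) * (α ^ (-1 : ℤ)) a) +
          (α (h n) - h (n + 1)) * a := by
      rw [map_mul, map_sub, ← zpow_add_apply, ← zpow_add_apply, Nat.cast_succ, add_comm (n : ℤ)]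
      simp [sub_mul]
    have h2 : ‖(α (h n) - h (n + 1)) * a‖ ≤ ε := by
      simpa using H n (Nat.lt_succ_self n) 0 (Nat.succ_pos n)
    have h3 := ih (a := (α ^ (-1 : ℤ)) a) fun k hk i hi => by
      rw [← zpow_add_apply]
      convert H k (by omega) (i + 1) (by omega) using 5
      push_cast
      ring
    rw [h1]
    refine (norm_add_le _ _).trans ?_
    rw [norm_aut_apply]
    push_cast
    linarith

variable {β : A ≃⋆ₐ[ℂ] A} {f g a a' : A} {δ ε : ℝ}

/-- If `β` moves `f` to an element `g` orthogonal to `f`, then `f a β(f)` vanishes; this is the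
approximate version. -/
lemma norm_mul_mul_apply_le_of_up (ha : β a' = a) (hf : ‖f‖ ≤ 1)
    (hg : ‖(β f - g) * a‖ ≤ δ) (hfg : ‖f * g * a‖ ≤ ε) (hcomm : ‖f * a' - a' * f‖ ≤ ε) :
    ‖f * a * β f‖ ≤ δ + 2 * ε := by
  have h : f * a * β f = -(f * β (f * a' - a' * f)) + f * ((β f - g) * a) + f * g * a := by
    simp only [map_sub, map_mul, ha, mul_sub, sub_mul, mul_assoc]
    abel
  have hle (y : A) : ‖f * y‖ ≤ ‖y‖ :=
    (norm_mul_le _ _).trans (mul_le_of_le_one_left (norm_nonneg _) hf)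
  rw [h]
  refine (norm_add₃_le).trans ?_
  have h1 : ‖-(f * β (f * a' - a' * f))‖ ≤ ε := by
    rw [norm_neg]
    exact (hle _).trans ((norm_aut_apply β _).le.trans hcomm)
  linarith [(hle _).trans hg]

/-- If `f` is the image under `β` of an element `g` orthogonal to `f`, then `f a β(f)` vanishes;
this is the approximate version. -/
lemma norm_mul_mul_apply_le_of_down (ha : β a' = a) (hf : ‖f‖ ≤ 1) (hg1 : ‖g‖ ≤ 1)
    (hg : ‖(β g - f) * a‖ ≤ δ) (hgf : ‖g * f * a'‖ ≤ ε) (hcomm : ‖f * a' - a' * f‖ ≤ ε) :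
    ‖f * a * β f‖ ≤ δ + 2 * ε := by
  have h : f * a * β f = -((β g - f) * a * β f) + -β (g * (f * a' - a' * f)) +
      β (g * f * a') := by
    simp only [map_sub, map_mul, ha, mul_sub, sub_mul, mul_assoc]
    abel
  rw [h]
  refine (norm_add₃_le).trans ?_
  rw [norm_neg, norm_neg, norm_aut_apply, norm_aut_apply]
  have h1 : ‖(β g - f) * a * β f‖ ≤ δ :=
    (norm_mul_le _ _).trans <| (mul_le_of_le_one_right (norm_nonneg _)
      ((norm_aut_apply β f).le.trans hf)).trans hg
  have h2 : ‖g * (f * a' - a' * f)‖ ≤ ε :=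
    (norm_mul_le _ _).trans <| (mul_le_of_le_one_left (norm_nonneg _) hg1).trans hcomm
  linarith

variable [PartialOrder A] [StarOrderedRing A]

/-- Rokhlin towers of height `2n` and `2n + 1` have levels `f` that are almost disjoint from their
translates under `αⁿ`, and they still sum up to an approximate unit. -/
lemma exists_almost_disjoint_towers {d : ℕ} (hα : RokhlinDimLE α d) {n : ℕ} (hn : 0 < n)
    (S : Finset A) {ε : ℝ} (hε : 0 < ε) :
    ∃ f : Fin (d + 1) → Fin 2 → ℕ → A,
      (∀ l (r : Fin 2), ∀ j < 2 * n + r, IsSelfAdjoint (f l r j) ∧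
        ∀ a ∈ S, ‖f l r j * a * (α ^ (n : ℤ)) (f l r j)‖ ≤ (n + 2) * ε) ∧
      ∀ a ∈ S,
        ‖(∑ l, ∑ r : Fin 2, ∑ j ∈ Finset.range (2 * n + r), f l r j) * a - a‖ ≤ ε := by
  classical
  let F : Finset A :=
    (Finset.range (n + 1) ×ˢ S).image fun q => (α ^ (-(q.1 : ℤ))) q.2
  have hF {i : ℕ} (hi : i ≤ n) {a : A} (ha : a ∈ S) : (α ^ (-(i : ℤ))) a ∈ F :=
    Finset.mem_image.mpr ⟨(i, a), by simp [ha]; omega, rfl⟩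
  have hF0 {a : A} (ha : a ∈ S) : a ∈ F := by simpa using hF (Nat.zero_le n) ha
  obtain ⟨f, hf, horth, hsum, hshift, -, hcomm⟩ := hα F (2 * n) (by omega) ε hε
  refine ⟨f, fun l r j hj => ⟨(hf l r j hj).1.isSelfAdjoint, fun a ha => ?_⟩,
    fun a ha => (hsum a (hF0 ha)).le⟩
  have hsplit : (n + 2 : ℝ) * ε = n * ε + 2 * ε := by ring
  rw [hsplit]
  have hcomm' := (hcomm l r j hj _ (hF le_rfl ha)).le
  have htr (i : ℕ) (hi : i + n < 2 * n + r) :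
      ‖((α ^ (n : ℤ)) (f l r i) - f l r (i + n)) * a‖ ≤ n * ε := by
    refine norm_zpow_sub_mul_le (h := fun k => f l r (i + k)) fun k hk m hm => ?_
    exact (hshift l r (i + k) (by omega) _ (hF hm.le ha)).le
  rcases lt_or_ge (j + n) (2 * n + r) with h | h
  · refine norm_mul_mul_apply_le_of_up (zpow_zpow_neg _ a) (hf l r j hj).2 (htr j h)
      (horth l r r j hj (j + n) h ?_ a (hF0 ha)).le hcomm'
    simp; omega
  · -- the height is at least `2n`, so that the level `n` steps below the `j`-th one exists
    obtain ⟨i, rfl⟩ : ∃ i, j = i + n := ⟨j - n, by omega⟩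
    refine norm_mul_mul_apply_le_of_down (zpow_zpow_neg _ a) (hf l r _ hj).2
      (hf l r i (by omega)).2 (htr i hj)
      (horth l r r i (by omega) (i + n) hj ?_ _ (hF le_rfl ha)).le hcomm'
    simp; omega

end Towers

/-! ### Traces on the crossed product -/

section CrossedProduct

open CrossedProduct

variable {A : Type*} [NonUnitalCStarAlgebra A] {α : A ≃⋆ₐ[ℂ] A}

lemma ConvAlg.norm_mono_le (n : ℤ) (a : A) : ‖mono α n a‖ ≤ ‖a‖ := by
  rw [norm_def]
  refine (universalSeminorm_isCStarSeminorm.le_l1Norm _).trans (le_of_eq ?_)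
  rw [l1Norm, toFinsupp_mono, Finsupp.sum_single_index]
  exact norm_zero

/-- The element `a uⁿ` of the crossed product, as a continuous linear function of `a`. -/
noncomputable def monoCLM (α : A ≃⋆ₐ[ℂ] A) (n : ℤ) : A →L[ℂ] CrossedProduct α :=
  UniformSpace.Completion.toComplL.comp
    ((mono α n).mkContinuous 1 fun a => (norm_mono_le n a).trans (one_mul ‖a‖).ge)

lemma monoCLM_apply (n : ℤ) (a : A) :
    monoCLM α n a = ((mono α n a : ConvAlg α) : CrossedProduct α) := rfl

lemma norm_monoCLM_apply_le (n : ℤ) (a : A) : ‖monoCLM α n a‖ ≤ ‖a‖ := by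
  rw [monoCLM_apply, UniformSpace.Completion.norm_coe]
  exact norm_mono_le n a

lemma monoCLM_mul_monoCLM (m n : ℤ) (a b : A) :
    monoCLM α m a * monoCLM α n b = monoCLM α (m + n) (a * (α ^ m) b) := by
  simp only [monoCLM_apply, ← coe_mul, mono_mul_mono]

lemma star_monoCLM_zero (a : A) : star (monoCLM α 0 a) = monoCLM α 0 (star a) := by
  simp only [monoCLM_apply, ← coe_star, star_mono]
  simp

lemma norm_condExp_le (x : CrossedProduct α) : ‖condExp α x‖ ≤ ‖x‖ := by
  induction x using UniformSpace.Completion.induction_on with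
  | hp => exact isClosed_le (by fun_prop) (by fun_prop)
  | ih f =>
    rw [UniformSpace.Completion.norm_coe]
    refine (congrArg norm (ContinuousLinearMap.fromCompletion_apply_coe _ f)).le.trans ?_
    exact norm_coeff_zero_le f

/-- A continuous linear functional on the crossed product that vanishes on the elements `a uⁿ`,
`n ≠ 0`, factors through the conditional expectation. -/
lemma eq_comp_condExp {τ : CrossedProduct α →L[ℂ] ℂ}
    (h : ∀ n : ℤ, n ≠ 0 → ∀ a, τ (monoCLM α n a) = 0) (x : CrossedProduct α) :
    τ x = τ (monoCLM α 0 (condExp α x)) := by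
  induction x using UniformSpace.Completion.induction_on with
  | hp => exact isClosed_eq (by fun_prop) (by fun_prop)
  | ih f =>
    induction f using ConvAlg.induction with
    | h0 =>
      have h : ((0 : ConvAlg α) : CrossedProduct α) = 0 := UniformSpace.Completion.coe_zero
      rw [h, map_zero, map_zero, map_zero, map_zero]
    | hadd f g hf hg =>
      have h : ((f + g : ConvAlg α) : CrossedProduct α) = f + g :=
        UniformSpace.Completion.coe_add f g
      rw [h, map_add, map_add, map_add, map_add, hf, hg]
    | hm n a =>
      rw [condExp_mono]
      split_ifs with hn
      · rw [hn, monoCLM_apply]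
      · rw [map_zero, map_zero, ← monoCLM_apply, h n hn]

lemma norm_mul_apply_neg {β : A ≃⋆ₐ[ℂ] A} {g : A} (hg : IsSelfAdjoint g) (a : A) :
    ‖g * a * β⁻¹ g‖ = ‖g * β (star a) * β g‖ := by
  have h : ∀ y, β (β⁻¹ y) = y := fun y => by
    rw [← StarAlgEquiv.mul_apply, mul_inv_cancel, StarAlgEquiv.one_apply]
  rw [← norm_aut_apply β, ← norm_star]
  simp only [map_mul, star_mul, h, hg.star_eq, ← map_star, mul_assoc]

/-- A tower element `f` almost disjoint from its translate contributes little to `τ (a uᵐ)`. -/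
lemma norm_trace_mul_monoCLM_le {τ : CrossedProduct α →L[ℂ] ℂ} (hτ : IsTracialState τ) {f : A}
    (hf : IsSelfAdjoint f) (m : ℤ) (a : A) {s : ℝ} (hs : 0 < s) :
    ‖τ (monoCLM α 0 f * monoCLM α m a)‖ ≤ s * ‖a‖ + s⁻¹ * ‖f * a * (α ^ m) f‖ := by
  have hsa : IsSelfAdjoint (monoCLM α 0 f) := by
    rw [IsSelfAdjoint, star_monoCLM_zero, hf.star_eq]
  refine (norm_trace_mul_le hτ hsa _ hs).trans ?_
  have h : monoCLM α 0 f * monoCLM α m a * monoCLM α 0 f =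
      monoCLM α m (f * a * (α ^ m) f) := by
    rw [monoCLM_mul_monoCLM, monoCLM_mul_monoCLM]
    simp
  rw [h]
  gcongr <;> exact norm_monoCLM_apply_le _ _

variable [PartialOrder A] [StarOrderedRing A]

lemma trace_monoCLM_eq_zero (hα : HasFiniteRokhlinDim α) {τ : CrossedProduct α →L[ℂ] ℂ}
    (hτ : IsTracialState τ) {m : ℤ} (hm : m ≠ 0) (a : A) : τ (monoCLM α m a) = 0 := by
  classical
  obtain ⟨d, hd⟩ := hα
  set n := m.natAbs
  have hn : 0 < n := Int.natAbs_pos.mpr hm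
  let C : ℝ := ∑ _l : Fin (d + 1), ∑ r : Fin 2, ∑ _j ∈ Finset.range (2 * n + r), (‖a‖ + (n + 2))
  -- tolerance `s²` in the towers balances the factor `s⁻¹` of `norm_trace_mul_le`
  have key (s : ℝ) (hs : 0 < s) : ‖τ (monoCLM α m a)‖ ≤ s ^ 2 + s * C := by
    obtain ⟨f, hf, hsum⟩ := exists_almost_disjoint_towers hd hn
      {a, (α ^ (n : ℤ)) (star a)} (pow_pos hs 2)
    have hdisj (l) (r : Fin 2) (j) (hj : j < 2 * n + r) :
        ‖f l r j * a * (α ^ m) (f l r j)‖ ≤ (n + 2) * s ^ 2 := by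
      rcases Int.natAbs_eq m with h | h
      · rw [h]
        exact (hf l r j hj).2 a (by simp)
      · rw [h, zpow_neg, norm_mul_apply_neg (hf l r j hj).1]
        exact (hf l r j hj).2 _ (by simp [n])
    set e := ∑ l, ∑ r : Fin 2, ∑ j ∈ Finset.range (2 * n + r), f l r j with he
    have h1 : τ (monoCLM α m a) = -τ (monoCLM α m (e * a - a)) +
        ∑ l, ∑ r : Fin 2, ∑ j ∈ Finset.range (2 * n + r),
          τ (monoCLM α 0 (f l r j) * monoCLM α m a) := by
      have h2 : monoCLM α m (e * a) = monoCLM α 0 e * monoCLM α m a := by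
        rw [monoCLM_mul_monoCLM]
        simp
      rw [map_sub, map_sub, h2, he]
      simp only [map_sum, Finset.sum_mul]
      ring
    rw [h1, Finset.mul_sum]
    refine (norm_add_le _ _).trans (add_le_add ?_ ?_)
    · rw [norm_neg]
      refine (τ.le_opNorm _).trans ?_
      rw [hτ.norm_eq_one, one_mul]
      exact (norm_monoCLM_apply_le _ _).trans (hsum a (by simp))
    · refine norm_sum_le_of_le _ fun l _ => ?_
      rw [Finset.mul_sum]
      refine norm_sum_le_of_le _ fun r _ => ?_
      rw [Finset.mul_sum]
      refine norm_sum_le_of_le _ fun j hj => ?_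
      have hj' := Finset.mem_range.mp hj
      refine (norm_trace_mul_monoCLM_le hτ (hf l r j hj').1 m a hs).trans ?_
      calc s * ‖a‖ + s⁻¹ * ‖f l r j * a * (α ^ m) (f l r j)‖
          ≤ s * ‖a‖ + s⁻¹ * ((n + 2) * s ^ 2) := by
            gcongr
            exact hdisj l r j hj'
        _ = s * (‖a‖ + (n + 2)) := by field_simp
  have hlim : Tendsto (fun s : ℝ => s ^ 2 + s * C) (𝓝[>] 0) (𝓝 0) := by
    have : Continuous fun s : ℝ => s ^ 2 + s * C := by fun_prop
    simpa using (this.tendsto 0).mono_left nhdsWithin_le_nhds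
  refine norm_le_zero_iff.mp (ge_of_tendsto hlim ?_)
  filter_upwards [self_mem_nhdsWithin] with s hs using key s hs

/-- The restriction to `A` of a trace on the crossed product is `α`-invariant: for `a = x y` the
elements `α(a) = (α(x) u) (y u⁻¹)` and `y x = (y u⁻¹) (α(x) u)` have the same trace. -/
lemma trace_monoCLM_zero_apply {τ : CrossedProduct α →L[ℂ] ℂ} (hτ : IsTracialState τ) (a : A) :
    τ (monoCLM α 0 (α a)) = τ (monoCLM α 0 a) := by
  have hmul (x y : A) : τ (monoCLM α 0 (α (x * y))) = τ (monoCLM α 0 (x * y)) := by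
    have h1 : monoCLM α 0 (α (x * y)) = monoCLM α 1 (α x) * monoCLM α (-1) y := by
      rw [monoCLM_mul_monoCLM]
      simp
    have h2 : monoCLM α 0 (y * x) = monoCLM α (-1) y * monoCLM α 1 (α x) := by
      rw [monoCLM_mul_monoCLM]
      have := zpow_neg_zpow (α := α) 1 x
      rw [zpow_one] at this
      rw [this]
      simp
    have h3 (v w : A) : monoCLM α 0 (v * w) = monoCLM α 0 v * monoCLM α 0 w := by
      rw [monoCLM_mul_monoCLM]
      simp
    rw [h1, hτ.map_mul_comm, ← h2, h3, hτ.map_mul_comm, ← h3]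
  have ha : a ∈ Submodule.span ℂ {b : A | 0 ≤ b} := by simp [CStarAlgebra.span_nonneg]
  induction ha using Submodule.span_induction with
  | mem b hb =>
    rw [← CFC.sqrt_mul_sqrt_self b hb]
    exact hmul _ _
  | zero => simp
  | add b c _ _ hb hc => simp only [map_add, hb, hc]
  | smul z b _ hb => simp only [map_smul, hb]

end CrossedProduct

end CrossedProd

theorem lemma1p6 {A : Type*} [NonUnitalCStarAlgebra A] [PartialOrder A] [StarOrderedRing A]
    [TopologicalSpace.SeparableSpace A] (α : A ≃⋆ₐ[ℂ] A)
    (hα : CrossedProd.HasFiniteRokhlinDim α)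
    (τ : CrossedProd.CrossedProduct α →L[ℂ] ℂ) (hτ : CrossedProd.IsTracialState τ) :
    ∃ ρ : A →L[ℂ] ℂ, CrossedProd.IsTracialState ρ ∧ (∀ a, ρ (α a) = ρ a) ∧
      ∀ x, τ x = ρ (CrossedProd.CrossedProduct.condExp α x) := by
  have hfac := CrossedProd.eq_comp_condExp fun n hn a =>
    CrossedProd.trace_monoCLM_eq_zero hα hτ hn a
  have hmul (x y : A) : CrossedProd.monoCLM α 0 (x * y) =
      CrossedProd.monoCLM α 0 x * CrossedProd.monoCLM α 0 y := by
    rw [CrossedProd.monoCLM_mul_monoCLM]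
    simp
  refine ⟨τ.comp (CrossedProd.monoCLM α 0), ⟨fun x => ?_, le_antisymm ?_ ?_, fun x y => ?_⟩,
    CrossedProd.trace_monoCLM_zero_apply hτ, hfac⟩
  · rw [ContinuousLinearMap.comp_apply, hmul, ← CrossedProd.star_monoCLM_zero]
    exact hτ.nonneg _
  · refine ContinuousLinearMap.opNorm_le_bound _ zero_le_one fun a => ?_
    refine (τ.le_opNorm _).trans ?_
    rw [hτ.norm_eq_one, one_mul, one_mul]
    exact CrossedProd.norm_monoCLM_apply_le 0 a
  · rw [← hτ.norm_eq_one]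
    refine ContinuousLinearMap.opNorm_le_bound _ (norm_nonneg _) fun x => ?_
    rw [hfac x]
    refine ((τ.comp (CrossedProd.monoCLM α 0)).le_opNorm _).trans ?_
    gcongr
    exact CrossedProd.norm_condExp_le x
  · simp only [ContinuousLinearMap.comp_apply, hmul, hτ.map_mul_comm]
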